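/- Let $\mathbb D$ be the open unit disc of $\mathbb C$ and let $H(\mathbb D)$ be the space of analytic functions on $\mathbb D$ with the compact-open topology $co$. Let $g\in H(\mathbb D)$, let $\varphi\colon\mathbb D\to\mathbb D$ be analytic, and let $$T_g^{\varphi}(f)(z)=\int_0^{\varphi(z)} f(\xi)g'(\xi)\,d\xi,\qquad f\in H(\mathbb D),\ z\in\mathbb D .$$ A weight is a continuous, strictly positive function $v\colon\mathbb D\to\mathbb R$ with $\lim_{|z|\to1}v(z)=0$. It is normal if it is radial ($v(z)=v(|z|)$), non-increasing with respect to $|z|$, and satisfies $$\inf_{k\in\mathbb N}\limsup_{n\to\infty}\frac{v(1-2^{-n-k})}{v(1-2^{-n})}<1\quad\text{and}\quad \sup_{n\in\mathbb N}\frac{v(1-2^{-n})}{v(1-2^{-n-1})}<\infty .$$ For a weight $v$ let $$H_v^\infty=\{f\in H(\mathbb D):\|f\|_{H_v^\infty}=\sup_{z}v(z)|f(z)|<\infty\},\qquad H_v^0=\{f\in H_v^\infty:\lim_{|z|\to1^-}v(z)|f(z)|=0\},$$ $$\mathcal B_v^\infty=\{f\in H(\mathbb D):\|f\|_{\mathcal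 B_v^\infty}=|f(0)|+\sup_{z}v(z)|f'(z)|<\infty\},\qquad \mathcal B_v^0=\{f\in \mathcal B_v^\infty:\lim_{|z|\to1^-}v(z)|f'(z)|=0\},$$ where $H_v^0$ and $\mathcal B_v^0$ carry the norms of $H_v^\infty$ and $\mathcal B_v^\infty$. Let $\mathcal X\subset H(\mathbb D)$ be a Banach space (with its own norm) that contains the constant functions. Let $\delta_z(f)=f(z)$ and $f_r(z)=f(rz)$, and consider the following conditions: (I) the closed unit ball of $\mathcal X$ is compact with respect to $co$; (II) $\lim_{|z|\to1}\|\delta_z\|_{\mathcal X\to\mathbb C}=\infty$; (III) for every $0<r<1$, $T_r\colon f\mapsto f_r$ is a compact operator $\mathcal X\to\mathcal X$; (IV) the operators $T_r\colon\mathcal X\to\mathcal X$, $f\mapsto f_r$, are well defined and bounded for $0<r<1$, and $\sup_{0<r<1}\|T_r\|_{\mathcal X\to\mathcal X}<\infty$; (V) there is a constant $c>0$ such that for every bounded $u\in H(\mathbb D)$ the multiplication $M_u f=uf$ is a bounded operator $\mathcal X\to\mathcal X$ with $\|M_u\|_{\mathcal X\to\mathcal X}\le c\,\|u\|_\infty$.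 That $T_g^\varphi\colon\mathcal X\to\mathcal Y$ is compact means that $T_g^\varphi(\mathcal X)\subset\mathcal Y$ and that the resulting linear operator is compact. Then: (i) If $\mathcal X$ satisfies (I)–(V) and the weight $v$ is normal, then $T_g^\varphi\colon\mathcal X\to H_v^\infty$ is compact if and only if $T_g^\varphi\colon\mathcal X\to H_v^0$ is compact. (ii) If $\mathcal X$ satisfies (I) and (IV), then for any weight $v$, $T_g^\varphi\colon\mathcal X\to\mathcal B_v^0$ is compact if and only if $T_g^\varphi\colon\mathcal X\to\mathcal B_v^\infty$ is compact and $g\circ\varphi\in\mathcal B_v^0$. -/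

import Mathlib

open Filter Topology

noncomputable section

namespace VolterraDisc

/-- The open unit disc of the complex plane. -/
abbrev Disc : Set ℂ := Metric.ball (0 : ℂ) 1

/-- The centre of the disc. -/
def origin : Disc := ⟨0, by simp⟩

/-- Extension by zero, so that the complex derivative `deriv` can be used for functions that are
only given on the disc. -/
def zeroExt (F : Disc → ℂ) (z : ℂ) : ℂ := by
  classical exact if h : z ∈ Disc then F ⟨z, h⟩ else 0

theorem zeroExt_of_mem (F : Disc → ℂ) {z : ℂ} (h : z ∈ Disc) : zeroExt F z = F ⟨z, h⟩ := by
  simp only [zeroExt]; exact dif_pos h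

theorem zeroExt_coe (F : Disc → ℂ) (z : Disc) : zeroExt F z = F z :=
  zeroExt_of_mem F z.2

/-- Analyticity of a function on the disc. -/
def IsHol (F : Disc → ℂ) : Prop := DifferentiableOn ℂ (zeroExt F) Disc

/-- The analytic functions on the disc, as a subspace of the continuous ones. -/
def holSubmodule : Submodule ℂ C(Disc, ℂ) where
  carrier := {f | IsHol f}
  add_mem' {f g} hf hg := (DifferentiableOn.add hf hg).congr fun z hz => by
    simp only [Pi.add_apply, zeroExt_of_mem _ hz, ContinuousMap.add_apply]
  zero_mem' := (differentiableOn_const (c := (0 : ℂ))).congr fun z hz => by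
    simp only [zeroExt_of_mem _ hz, ContinuousMap.zero_apply]
  smul_mem' c f hf := (DifferentiableOn.const_smul hf c).congr fun z hz => by
    simp only [Pi.smul_apply, zeroExt_of_mem _ hz, ContinuousMap.smul_apply]

/-- The space `H(𝔻)` of analytic functions on the disc. -/
def HolD : Type := holSubmodule

instance : AddCommGroup HolD := inferInstanceAs (AddCommGroup holSubmodule)

instance : Module ℂ HolD := inferInstanceAs (Module ℂ holSubmodule)

/-- `H(𝔻)` carries the compact-open topology, as a subspace of `C(Disc, ℂ)`. -/
instance : TopologicalSpace HolD := inferInstanceAs (TopologicalSpace holSubmodule)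

/-- The value `f z`. -/
def HolD.val (f : HolD) (z : Disc) : ℂ := f.1 z

theorem HolD.val_zero (z : Disc) : (0 : HolD).val z = 0 := rfl

/-- The value `f'(z)` of the complex derivative. -/
def HolD.der (f : HolD) (z : Disc) : ℂ := deriv (zeroExt f.val) z

theorem HolD.isHol (f : HolD) : IsHol f.val := f.2

theorem HolD.differentiableAt (f : HolD) (z : Disc) :
    DifferentiableAt ℂ (zeroExt f.val) z :=
  (f.isHol z z.2).differentiableAt (Metric.isOpen_ball.mem_nhds z.2)

theorem HolD.ext_val {f g : HolD} (h : ∀ z, f.val z = g.val z) : f = g :=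
  Subtype.ext (ContinuousMap.ext h)

theorem HolD.der_add (f g : HolD) (z : Disc) : (f + g).der z = f.der z + g.der z := by
  have h : zeroExt (f + g).val = zeroExt f.val + zeroExt g.val := by
    funext w
    by_cases hw : w ∈ Disc
    · simp only [Pi.add_apply, zeroExt_of_mem _ hw]; rfl
    · simp only [Pi.add_apply, zeroExt, hw, dite_false, add_zero]
  simp only [HolD.der, h]
  exact deriv_add (f.differentiableAt z) (g.differentiableAt z)

theorem HolD.der_smul (c : ℂ) (f : HolD) (z : Disc) : (c • f).der z = c * f.der z := by
  have h : zeroExt (c • f).val = fun w => c * zeroExt f.val w := by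
    funext w
    by_cases hw : w ∈ Disc
    · simp only [zeroExt_of_mem _ hw]; rfl
    · simp only [zeroExt, hw, dite_false, mul_zero]
  simp only [HolD.der, h]
  exact deriv_const_mul c (f.differentiableAt z)

theorem HolD.eq_zero_of_der {f : HolD} (h0 : f.val origin = 0) (h : ∀ z, f.der z = 0) : f = 0 := by
  apply HolD.ext_val
  intro z
  have := Metric.isOpen_ball.is_const_of_deriv_eq_zero
    (convex_ball (0 : ℂ) 1).isPreconnected f.isHol (fun w hw => h ⟨w, hw⟩) z.2 origin.2
  rw [zeroExt_coe, zeroExt_coe, h0] at this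
  exact this

/-- The filter `|z| → 1` on the disc. -/
def toBoundary : Filter Disc := comap (fun z : Disc => ‖(z : ℂ)‖) (𝓝 1)

/-- Analytic selfmaps of the disc. -/
structure SelfMap where
  toFun : Disc → Disc
  isHol : IsHol fun z => (toFun z : ℂ)

/-- The composition `g ∘ φ`. -/
def HolD.comp (g : HolD) (φ : SelfMap) : HolD :=
  have h : IsHol fun z => g.val (φ.toFun z) :=
    (DifferentiableOn.comp g.isHol φ.isHol fun z hz => by
      rw [zeroExt_of_mem _ hz]; exact (φ.toFun ⟨z, hz⟩).2).congr fun z hz => by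
      simp only [Function.comp_apply, zeroExt_of_mem _ hz, zeroExt_coe]
  ⟨⟨fun z => g.val (φ.toFun z), by
    have hc := h.continuousOn.domRestrict
    refine hc.congr fun z => ?_
    simp only [Set.domRestrict_apply, zeroExt_coe]⟩, h⟩

/-- The generalized Volterra operator
`T_g^φ(f)(z) = ∫_0^{φ(z)} f(ξ) g'(ξ) dξ`, the integral being taken along the segment
`ξ = t φ(z)`, `0 ≤ t ≤ 1`. -/
def volterra (g : HolD) (φ : SelfMap) (f : HolD) (z : Disc) : ℂ :=
  ∫ t in (0 : ℝ)..1, zeroExt f.val ((t : ℂ) * (φ.toFun z : ℂ)) *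
    zeroExt g.der ((t : ℂ) * (φ.toFun z : ℂ)) * (φ.toFun z : ℂ)

/-- Weights: continuous strictly positive functions on the disc with `v(z) → 0` as `|z| → 1`. -/
structure Weight where
  toFun : Disc → ℝ
  continuous : Continuous toFun
  pos : ∀ z, 0 < toFun z
  tendsto_zero : Tendsto toFun toBoundary (𝓝 0)

instance : CoeFun Weight fun _ => Disc → ℝ := ⟨Weight.toFun⟩

/-- The point `1 - 2^{-n}` of the disc. -/
def dyadicPt (n : ℕ) : Disc := ⟨((1 - (2⁻¹ : ℝ) ^ n : ℝ) : ℂ), by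
  have h1 : (0 : ℝ) < 2⁻¹ ^ n := by positivity
  have h2 : (2⁻¹ : ℝ) ^ n ≤ 1 := pow_le_one₀ (by norm_num) (by norm_num)
  rw [Metric.mem_ball, dist_zero_right, Complex.norm_real, Real.norm_eq_abs, abs_lt]
  constructor <;> linarith⟩

/-- Normal weights. Since `v` is positive and non-increasing in `|z|`, all quotients in `limsup_lt`
lie in `(0, 1]`, so that the real `limsup` and `⨅` have their usual meaning. -/
structure Weight.IsNormal (v : Weight) : Prop where
  radial : ∀ z w : Disc, ‖(z : ℂ)‖ = ‖(w : ℂ)‖ → v z = v w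
  antitone : ∀ z w : Disc, ‖(z : ℂ)‖ ≤ ‖(w : ℂ)‖ → v w ≤ v z
  limsup_lt : (⨅ k : ℕ, limsup (fun n : ℕ => v (dyadicPt (n + k)) / v (dyadicPt n)) atTop) < 1
  sup_finite : BddAbove (Set.range fun n : ℕ => v (dyadicPt n) / v (dyadicPt (n + 1)))

theorem bddAbove_add (v : Weight) {a b c : Disc → ℂ} (hc : ∀ z, c z = a z + b z)
    (ha : BddAbove (Set.range fun z => v z * ‖a z‖))
    (hb : BddAbove (Set.range fun z => v z * ‖b z‖)) :
    BddAbove (Set.range fun z => v z * ‖c z‖) ∧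
      (⨆ z, v z * ‖c z‖) ≤ (⨆ z, v z * ‖a z‖) + ⨆ z, v z * ‖b z‖ := by
  have key : ∀ z, v z * ‖c z‖ ≤ (⨆ z, v z * ‖a z‖) + ⨆ z, v z * ‖b z‖ := fun z => by
    have h1 := le_ciSup ha z
    have h2 := le_ciSup hb z
    have h3 := mul_le_mul_of_nonneg_left (norm_add_le (a z) (b z)) (v.pos z).le
    rw [← hc, mul_add] at h3
    exact h3.trans (add_le_add h1 h2)
  have : Nonempty Disc := ⟨origin⟩
  exact ⟨⟨_, by rintro _ ⟨z, rfl⟩; exact key z⟩, ciSup_le key⟩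

theorem bddAbove_smul (v : Weight) {a c : Disc → ℂ} (r : ℂ) (hc : ∀ z, c z = r * a z)
    (ha : BddAbove (Set.range fun z => v z * ‖a z‖)) :
    BddAbove (Set.range fun z => v z * ‖c z‖) := by
  obtain ⟨M, hM⟩ := ha
  refine ⟨‖r‖ * M, ?_⟩
  rintro _ ⟨z, rfl⟩
  have := mul_le_mul_of_nonneg_left (hM ⟨z, rfl⟩) (norm_nonneg r)
  simp only [hc, norm_mul] at this ⊢
  linarith

theorem iSup_smul_eq (v : Weight) {a c : Disc → ℂ} (r : ℂ) (hc : ∀ z, c z = r * a z) :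
    (⨆ z, v z * ‖c z‖) = ‖r‖ * ⨆ z, v z * ‖a z‖ := by
  rw [Real.mul_iSup_of_nonneg (norm_nonneg r)]
  congr 1; funext z; rw [hc, norm_mul]; ring

theorem eq_zero_of_iSup (v : Weight) {a : Disc → ℂ}
    (ha : BddAbove (Set.range fun z => v z * ‖a z‖)) (h : (⨆ z, v z * ‖a z‖) ≤ 0) (z : Disc) :
    a z = 0 := by
  have h1 := (le_ciSup ha z).trans h
  have h2 : ‖a z‖ ≤ 0 := nonpos_of_mul_nonpos_right h1 (v.pos z)
  exact norm_le_zero_iff.1 h2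

theorem iSup_weight_nonneg (v : Weight) (a : Disc → ℂ) : 0 ≤ ⨆ z, v z * ‖a z‖ :=
  Real.iSup_nonneg fun z => mul_nonneg (v.pos z).le (norm_nonneg _)

theorem tendsto_weight_add (v : Weight) {a b c : Disc → ℂ} (hc : ∀ z, c z = a z + b z)
    (ha : Tendsto (fun z => v z * ‖a z‖) toBoundary (𝓝 0))
    (hb : Tendsto (fun z => v z * ‖b z‖) toBoundary (𝓝 0)) :
    Tendsto (fun z => v z * ‖c z‖) toBoundary (𝓝 0) := by
  refine squeeze_zero (fun z => mul_nonneg (v.pos z).le (norm_nonneg _)) (fun z => ?_)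
    (by simpa using ha.add hb)
  have h3 := mul_le_mul_of_nonneg_left (norm_add_le (a z) (b z)) (v.pos z).le
  rw [← hc, mul_add] at h3
  exact h3

theorem tendsto_weight_smul (v : Weight) {a c : Disc → ℂ} (r : ℂ) (hc : ∀ z, c z = r * a z)
    (ha : Tendsto (fun z => v z * ‖a z‖) toBoundary (𝓝 0)) :
    Tendsto (fun z => v z * ‖c z‖) toBoundary (𝓝 0) := by
  have h := ha.const_mul ‖r‖
  rw [mul_zero] at h
  refine h.congr fun z => ?_
  rw [hc, norm_mul]; ring

theorem HolD.der_zero (z : Disc) : (0 : HolD).der z = 0 := by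
  have := HolD.der_smul 0 0 z
  rwa [zero_smul, zero_mul] at this

/-! ### The weighted spaces `H_v^∞` and `H_v^0` -/

/-- The analytic functions with `sup_z v(z)|f(z)| < ∞`. -/
def hvInfSubmodule (v : Weight) : Submodule ℂ HolD where
  carrier := {f | BddAbove (Set.range fun z => v z * ‖f.val z‖)}
  add_mem' {_ _} hf hg := (bddAbove_add v (fun _ => rfl) hf hg).1
  zero_mem' := ⟨0, by rintro _ ⟨z, rfl⟩; simp [HolD.val_zero]⟩
  smul_mem' c _ hf := bddAbove_smul v c (fun _ => rfl) hf

/-- The space `H_v^∞`. It is a separate type since its topology is given by its norm, not by the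
compact-open topology. -/
def HvInf (v : Weight) : Type := hvInfSubmodule v

instance (v : Weight) : AddCommGroup (HvInf v) :=
  inferInstanceAs (AddCommGroup (hvInfSubmodule v))

instance (v : Weight) : Module ℂ (HvInf v) :=
  inferInstanceAs (Module ℂ (hvInfSubmodule v))

/-- The inclusion `H_v^∞ ⊂ H(𝔻)`. -/
def HvInf.incl (v : Weight) : HvInf v →ₗ[ℂ] HolD := (hvInfSubmodule v).subtype

/-- `‖f‖ = sup_z v(z)|f(z)|`. -/
instance (v : Weight) : Norm (HvInf v) := ⟨fun f => ⨆ z, v z * ‖(HvInf.incl v f).val z‖⟩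

theorem HvInf.core (v : Weight) : NormedSpace.Core ℂ (HvInf v) where
  norm_nonneg f := iSup_weight_nonneg v _
  norm_smul c f := iSup_smul_eq v c fun _ => rfl
  norm_triangle f g := (bddAbove_add v (fun _ => rfl) f.2 g.2).2
  norm_eq_zero_iff f := by
    constructor
    · intro h
      exact Subtype.ext (HolD.ext_val (eq_zero_of_iSup v f.2 (le_of_eq h)))
    · rintro rfl
      have := iSup_smul_eq v (a := (HvInf.incl v 0).val) (c := (HvInf.incl v 0).val) 0
        fun z => by simp [HolD.val_zero]
      rw [norm_zero, zero_mul] at this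
      exact this

instance (v : Weight) : NormedAddCommGroup (HvInf v) := NormedAddCommGroup.ofCore (HvInf.core v)

instance (v : Weight) : NormedSpace ℂ (HvInf v) := NormedSpace.ofCore (HvInf.core v)

/-- The space `H_v^0`, with the norm of `H_v^∞`. -/
def Hv0 (v : Weight) : Submodule ℂ (HvInf v) where
  carrier := {f | Tendsto (fun z => v z * ‖(HvInf.incl v f).val z‖) toBoundary (𝓝 0)}
  add_mem' {_ _} hf hg := tendsto_weight_add v (fun _ => rfl) hf hg
  zero_mem' := by simp [HolD.val_zero, tendsto_const_nhds]
  smul_mem' c _ hf := tendsto_weight_smul v c (fun _ => rfl) hf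

/-- The inclusion `H_v^0 ⊂ H(𝔻)`. -/
def Hv0.incl (v : Weight) : Hv0 v →ₗ[ℂ] HolD := HvInf.incl v ∘ₗ (Hv0 v).subtype

/-! ### The Bloch-type spaces `B_v^∞` and `B_v^0` -/

/-- The analytic functions with `sup_z v(z)|f'(z)| < ∞`. -/
def bvInfSubmodule (v : Weight) : Submodule ℂ HolD where
  carrier := {f | BddAbove (Set.range fun z => v z * ‖f.der z‖)}
  add_mem' {f g} hf hg := (bddAbove_add v (HolD.der_add f g) hf hg).1
  zero_mem' := ⟨0, by rintro _ ⟨z, rfl⟩; simp [HolD.der_zero]⟩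
  smul_mem' c f hf := bddAbove_smul v c (HolD.der_smul c f) hf

/-- The Bloch-type space `B_v^∞`, topologized by its norm. -/
def BvInf (v : Weight) : Type := bvInfSubmodule v

instance (v : Weight) : AddCommGroup (BvInf v) :=
  inferInstanceAs (AddCommGroup (bvInfSubmodule v))

instance (v : Weight) : Module ℂ (BvInf v) :=
  inferInstanceAs (Module ℂ (bvInfSubmodule v))

/-- The inclusion `B_v^∞ ⊂ H(𝔻)`. -/
def BvInf.incl (v : Weight) : BvInf v →ₗ[ℂ] HolD := (bvInfSubmodule v).subtype

/-- `‖f‖ = |f(0)| + sup_z v(z)|f'(z)|`. -/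
instance (v : Weight) : Norm (BvInf v) :=
  ⟨fun f => ‖(BvInf.incl v f).val origin‖ + ⨆ z, v z * ‖(BvInf.incl v f).der z‖⟩

theorem BvInf.core (v : Weight) : NormedSpace.Core ℂ (BvInf v) where
  norm_nonneg f := add_nonneg (norm_nonneg _) (iSup_weight_nonneg v _)
  norm_smul c f := by
    have h1 := iSup_smul_eq v c (HolD.der_smul c (BvInf.incl v f))
    have h2 : ‖(BvInf.incl v (c • f)).val origin‖ = ‖c‖ * ‖(BvInf.incl v f).val origin‖ :=
      norm_mul c _
    change _ + (⨆ z, v z * ‖(c • BvInf.incl v f).der z‖) = ‖c‖ * (_ + _)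
    rw [h1, h2, mul_add]
  norm_triangle f g := by
    have h1 := (bddAbove_add v (HolD.der_add (BvInf.incl v f) (BvInf.incl v g)) f.2 g.2).2
    have h2 : ‖(BvInf.incl v (f + g)).val origin‖ ≤
      ‖(BvInf.incl v f).val origin‖ + ‖(BvInf.incl v g).val origin‖ := norm_add_le _ _
    exact (add_le_add h2 h1).trans (le_of_eq (add_add_add_comm _ _ _ _))
  norm_eq_zero_iff f := by
    constructor
    · intro h
      change _ + _ = (0 : ℝ) at h
      have h1 := norm_nonneg ((BvInf.incl v f).val origin)
      have h2 := iSup_weight_nonneg v (BvInf.incl v f).der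
      have h3 : ‖(BvInf.incl v f).val origin‖ ≤ 0 := by linarith
      have h4 : (⨆ z, v z * ‖(BvInf.incl v f).der z‖) ≤ 0 := by linarith
      exact Subtype.ext (HolD.eq_zero_of_der (norm_le_zero_iff.1 h3) (eq_zero_of_iSup v f.2 h4))
    · rintro rfl
      change _ + _ = (0 : ℝ)
      simp [HolD.val_zero, HolD.der_zero]

instance (v : Weight) : NormedAddCommGroup (BvInf v) := NormedAddCommGroup.ofCore (BvInf.core v)

instance (v : Weight) : NormedSpace ℂ (BvInf v) := NormedSpace.ofCore (BvInf.core v)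

/-- The little Bloch-type space `B_v^0`, with the norm of `B_v^∞`. -/
def Bv0 (v : Weight) : Submodule ℂ (BvInf v) where
  carrier := {f | Tendsto (fun z => v z * ‖(BvInf.incl v f).der z‖) toBoundary (𝓝 0)}
  add_mem' {f g} hf hg :=
    tendsto_weight_add v (HolD.der_add (BvInf.incl v f) (BvInf.incl v g)) hf hg
  zero_mem' := by simp [HolD.der_zero, tendsto_const_nhds]
  smul_mem' c f hf := tendsto_weight_smul v c (HolD.der_smul c (BvInf.incl v f)) hf

/-- The inclusion `B_v^0 ⊂ H(𝔻)`. -/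
def Bv0.incl (v : Weight) : Bv0 v →ₗ[ℂ] HolD := BvInf.incl v ∘ₗ (Bv0 v).subtype

/-! ### Banach spaces of analytic functions

A Banach space `X ⊂ H(𝔻)` is a Banach space `X` with an injective linear map `ι : X → H(𝔻)`. -/

section Conditions

variable {X : Type*} [NormedAddCommGroup X] [NormedSpace ℂ X]

/-- `X` contains the constant functions. -/
def ContainsConstants (ι : X →ₗ[ℂ] HolD) : Prop := ∀ c : ℂ, ∃ f : X, ∀ z, (ι f).val z = c

/-- Condition (I): the closed unit ball is compact in the compact-open topology. -/
def CondI (ι : X →ₗ[ℂ] HolD) : Prop := IsCompact (ι '' Metric.closedBall 0 1)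

/-- The norm `‖δ_z‖` of the evaluation functional (`∞` if it is unbounded). -/
def evalNorm (ι : X →ₗ[ℂ] HolD) (z : Disc) : ENNReal :=
  ⨆ f ∈ Metric.closedBall (0 : X) 1, ‖(ι f).val z‖ₑ

/-- Condition (II): `‖δ_z‖ → ∞` as `|z| → 1`. -/
def CondII (ι : X →ₗ[ℂ] HolD) : Prop := Tendsto (evalNorm ι) toBoundary (𝓝 ⊤)

/-- `T` is the dilation `f ↦ f_r`, `f_r(z) = f(rz)`, on `X`. -/
def IsDilation (ι : X →ₗ[ℂ] HolD) (r : ℝ) (T : X → X) : Prop :=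
  ∀ f z, (ι (T f)).val z = zeroExt (ι f).val ((r : ℂ) * z)

/-- Condition (III): all dilations, `0 < r < 1`, are compact operators on `X`. -/
def CondIII (ι : X →ₗ[ℂ] HolD) : Prop :=
  ∀ r ∈ Set.Ioo (0 : ℝ) 1, ∃ T : X →ₗ[ℂ] X, IsDilation ι r T ∧ IsCompactOperator T

/-- Condition (IV): the dilations, `0 < r < 1`, are uniformly bounded operators on `X`. -/
def CondIV (ι : X →ₗ[ℂ] HolD) : Prop :=
  ∃ C : ℝ, ∀ r ∈ Set.Ioo (0 : ℝ) 1, ∃ T : X →L[ℂ] X, IsDilation ι r T ∧ ‖T‖ ≤ C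

/-- Condition (V): every `u ∈ H^∞` multiplies `X` into `X`, with `‖M_u‖ ≤ c ‖u‖_∞`. -/
def CondV (ι : X →ₗ[ℂ] HolD) : Prop :=
  ∃ c : ℝ, 0 < c ∧ ∀ u : HolD, BddAbove (Set.range fun z => ‖u.val z‖) →
    ∃ M : X →L[ℂ] X, (∀ f z, (ι (M f)).val z = u.val z * (ι f).val z) ∧
      ‖M‖ ≤ c * ⨆ z, ‖u.val z‖

/-- The map `T`, defined on `H(𝔻)`, maps the space `X` into the space `Y`, both embedded in `H(𝔻)`,
and is a compact linear operator `X → Y`. -/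
def IsCompactBetween {Y : Type*} [NormedAddCommGroup Y] [NormedSpace ℂ Y]
    (ι : X →ₗ[ℂ] HolD) (κ : Y →ₗ[ℂ] HolD) (T : HolD → Disc → ℂ) : Prop :=
  ∃ S : X →ₗ[ℂ] Y, (∀ f z, (κ (S f)).val z = T (ι f) z) ∧ IsCompactOperator S

end Conditions

end VolterraDisc

end

open VolterraDisc

/-!
If `F = T_g^φ f`, then `F' = (f ∘ φ) (g ∘ φ)'`, so multiplying `f` by `z ^ n` multiplies `F'` by
`φ ^ n`, and dilating `f` affects only the factor `f ∘ φ`. If `T_g^φ` is compact into a Bloch-type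
space and the derivatives of the images of a bounded sequence converge pointwise, then they
converge, along a subsequence, uniformly with respect to the weight.

* Dilations: `(T_g^φ f_r)'` is a bounded multiple of `(g ∘ φ)'` and tends pointwise to
  `(T_g^φ f)'` as `r → 1`. Hence `T_g^φ f` belongs to the little space if `g ∘ φ` does.
* Powers: `φ ^ n (T_g^φ f)'` tends pointwise to `0`, so it is uniformly small for some `n`. This
  controls `(T_g^φ f)'` where `|φ|` is close to `1`; elsewhere Cauchy's estimate for `φ'` suffices.

The second argument applies to `H_v^∞` because, for a normal weight, differentiation is bounded
from `H_v^∞` to the weighted space for `(1 - |z|) v(z)`, and little-o growth of `f'` in the latter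
gives little-o growth of `f` in the former: with `M n` the maximum modulus of `f` on
`|z| ≤ 1 - 2⁻ⁿ` and `a n = v (1 - 2⁻ⁿ)`, integration gives
`a (n + k) * M (n + k) ≤ a (n + k) * M n + k * ε`, and normality provides `k` and `q < 1` with
`a (n + k) ≤ q * a n`.
-/

namespace VolterraDisc

/-! ### Limits of nonnegative quantities -/

theorem tendsto_zero_of_forall_le_add {α : Type*} {l : Filter α} {a : α → ℝ} (ha : ∀ x, 0 ≤ a x)
    (h : ∀ ε > 0, ∃ b : α → ℝ, Tendsto b l (𝓝 0) ∧ ∀ᶠ x in l, a x ≤ b x + ε) :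
    Tendsto a l (𝓝 0) := by
  refine tendsto_order.2 ⟨fun c hc => .of_forall fun x => hc.trans_le (ha x), fun ε hε => ?_⟩
  obtain ⟨b, hb, hab⟩ := h (ε / 2) (half_pos hε)
  filter_upwards [hab, hb.eventually_lt_const (half_pos hε)] with x h₁ h₂
  linarith

theorem le_pow_mul_sum_add_of_le_mul_add {b : ℕ → ℝ} {k N : ℕ} {q c : ℝ} (hb : ∀ n, 0 ≤ b n)
    (hk : 0 < k) (hq : q ∈ Set.Ico (0 : ℝ) 1) (hc : 0 ≤ c)
    (h : ∀ n ≥ N, b (n + k) ≤ q * b n + c) {n : ℕ} (hn : N ≤ n) :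
    b n ≤ q ^ ((n - N) / k) * ∑ j ∈ Finset.range (N + k), b j + c / (1 - q) := by
  have hq1 : 0 < 1 - q := sub_pos.2 hq.2
  induction n using Nat.strong_induction_on with
  | _ n ih =>
    rcases lt_or_ge n (N + k) with hnk | hnk
    · rw [Nat.div_eq_of_lt (by omega), pow_zero, one_mul]
      have := Finset.single_le_sum (fun j _ => hb j) (Finset.mem_range.2 hnk)
      have := div_nonneg hc hq1.le
      linarith
    · obtain ⟨m, rfl⟩ := Nat.exists_eq_add_of_le' (le_of_add_le_right hnk)
      have hm : N ≤ m := by omega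
      rw [Nat.sub_add_comm hm, Nat.add_div_right _ hk, pow_succ']
      calc b (m + k) ≤ q * b m + c := h m hm
        _ ≤ q * (q ^ ((m - N) / k) * ∑ j ∈ Finset.range (N + k), b j + c / (1 - q)) + c := by
          gcongr
          · exact hq.1
          · exact ih m (by omega) hm
        _ = q * q ^ ((m - N) / k) * ∑ j ∈ Finset.range (N + k), b j + c / (1 - q) := by
          field_simp
          ring

theorem tendsto_zero_of_eventually_le_mul_add {b : ℕ → ℝ} {k : ℕ} {q : ℝ} (hb : ∀ n, 0 ≤ b n)
    (hk : 0 < k) (hq : q ∈ Set.Ico (0 : ℝ) 1)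
    (h : ∀ ε > 0, ∀ᶠ n in atTop, b (n + k) ≤ q * b n + ε) : Tendsto b atTop (𝓝 0) := by
  refine tendsto_zero_of_forall_le_add hb fun ε hε => ?_
  have hq1 : 0 < 1 - q := sub_pos.2 hq.2
  obtain ⟨N, hN⟩ := eventually_atTop.1 (h _ (mul_pos hε hq1))
  refine ⟨fun n => q ^ ((n - N) / k) * ∑ j ∈ Finset.range (N + k), b j, ?_, ?_⟩
  · simpa using ((tendsto_pow_atTop_nhds_zero_of_lt_one hq.1 hq.2).comp
      ((Nat.tendsto_div_const_atTop hk.ne').comp (tendsto_sub_atTop_nat N))).mul_const _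
  · filter_upwards [eventually_ge_atTop N] with n hn
    simpa [hq1.ne'] using
      le_pow_mul_sum_add_of_le_mul_add hb hk hq (mul_pos hε hq1).le hN hn

/-! ### The disc and its boundary -/

theorem norm_lt_one (z : Disc) : ‖(z : ℂ)‖ < 1 := mem_ball_zero_iff.1 z.2

theorem norm_ofReal_mul {t : ℝ} (ht : 0 ≤ t) (z : ℂ) : ‖(t : ℂ) * z‖ = t * ‖z‖ := by
  rw [norm_mul, Complex.norm_of_nonneg ht]

theorem ofReal_mul_mem_disc {t : ℝ} (ht : t ∈ Set.Icc (0 : ℝ) 1) (z : Disc) :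
    (t : ℂ) * z ∈ Disc := by
  rw [mem_ball_zero_iff, norm_ofReal_mul ht.1]
  exact (mul_le_of_le_one_left (norm_nonneg _) ht.2).trans_lt (norm_lt_one z)

theorem isCompact_setOf_norm_le {r : ℝ} (hr : r < 1) : IsCompact {z : Disc | ‖(z : ℂ)‖ ≤ r} := by
  have h : {z : Disc | ‖(z : ℂ)‖ ≤ r} = (↑) ⁻¹' Metric.closedBall (0 : ℂ) r := by
    ext z
    exact mem_closedBall_zero_iff.symm
  rw [h, Topology.IsInducing.subtypeVal.isCompact_preimage_iff]
  · exact isCompact_closedBall 0 r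
  · rw [Subtype.range_coe]
    exact Metric.closedBall_subset_ball hr

theorem cocompact_le_toBoundary : cocompact Disc ≤ toBoundary := by
  refine tendsto_iff_comap.1 (tendsto_order.2 ⟨fun r hr => ?_, fun r hr => ?_⟩)
  · filter_upwards [(isCompact_setOf_norm_le hr).compl_mem_cocompact] with z hz
    exact not_le.1 hz
  · exact .of_forall fun z => (norm_lt_one z).trans hr

theorem bddAbove_range_of_tendsto_toBoundary {F : Disc → ℝ} (hF : Continuous F)
    (h : Tendsto F toBoundary (𝓝 0)) : BddAbove (Set.range F) :=
  (ZeroAtInftyContinuousMap.isBounded_range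
    ⟨⟨F, hF⟩, h.mono_left cocompact_le_toBoundary⟩).bddAbove

theorem norm_dyadicPt (n : ℕ) : ‖(dyadicPt n : ℂ)‖ = 1 - (2⁻¹ : ℝ) ^ n := by
  have : (2⁻¹ : ℝ) ^ n ≤ 1 := pow_le_one₀ (by norm_num) (by norm_num)
  rw [dyadicPt, Complex.norm_of_nonneg (sub_nonneg.2 this)]

theorem monotone_norm_dyadicPt : Monotone fun n => ‖(dyadicPt n : ℂ)‖ := fun m n h => by
  simp only [norm_dyadicPt]
  exact sub_le_sub_left (pow_le_pow_of_le_one (by norm_num) (by norm_num) h) 1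

theorem one_add_norm_dyadicPt_div_two (n : ℕ) :
    (1 + ‖(dyadicPt n : ℂ)‖) / 2 = ‖(dyadicPt (n + 1) : ℂ)‖ := by
  rw [norm_dyadicPt, norm_dyadicPt, pow_succ]
  ring

theorem exists_norm_dyadicPt_le_lt (z : Disc) :
    ∃ n, ‖(dyadicPt n : ℂ)‖ ≤ ‖(z : ℂ)‖ ∧ ‖(z : ℂ)‖ < ‖(dyadicPt (n + 1) : ℂ)‖ := by
  obtain ⟨n, h₁, h₂⟩ := exists_nat_pow_near_of_lt_one (sub_pos.2 (norm_lt_one z))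
    (sub_le_self 1 (norm_nonneg _)) (y := (2⁻¹ : ℝ)) (by norm_num) (by norm_num)
  refine ⟨n, ?_, ?_⟩ <;> rw [norm_dyadicPt] <;> linarith

theorem hasBasis_toBoundary :
    toBoundary.HasBasis (fun _ => True)
      fun n : ℕ => {z : Disc | ‖(dyadicPt n : ℂ)‖ ≤ ‖(z : ℂ)‖} := by
  refine ⟨fun s => ⟨?_, ?_⟩⟩
  · rintro ⟨u, hu, hus⟩
    obtain ⟨r, hr, hru⟩ := mem_nhdsLE_iff_exists_Ioc_subset.1 (mem_nhdsWithin_of_mem_nhds hu)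
    have hlim : Tendsto (fun n => ‖(dyadicPt n : ℂ)‖) atTop (𝓝 1) := by
      simp only [norm_dyadicPt]
      simpa using (tendsto_pow_atTop_nhds_zero_of_lt_one (r := (2⁻¹ : ℝ)) (by norm_num)
        (by norm_num)).const_sub 1
    obtain ⟨n, hn⟩ := (hlim.eventually_const_lt hr).exists
    exact ⟨n, trivial, fun z hz => hus (hru ⟨hn.trans_le hz, (norm_lt_one z).le⟩)⟩
  · rintro ⟨n, -, hn⟩
    exact mem_of_superset (preimage_mem_comap (Ici_mem_nhds (norm_lt_one (dyadicPt n)))) hn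

/-! ### Analytic functions -/

theorem HolD.continuous_val (f : HolD) : Continuous f.val := f.1.continuous

/-- The element of `H(𝔻)` given by a function that is analytic on the disc. -/
noncomputable def HolD.ofDifferentiableOn (G : ℂ → ℂ) (hG : DifferentiableOn ℂ G Disc) : HolD :=
  ⟨⟨fun z => G z, hG.continuousOn.domRestrict⟩, hG.congr fun _ hz => zeroExt_of_mem _ hz⟩

theorem HolD.hasDerivAt (f : HolD) (z : Disc) : HasDerivAt (zeroExt f.val) (f.der z) z :=
  (f.differentiableAt z).hasDerivAt

theorem HolD.der_eq_of_hasDerivAt {f : HolD} {G : ℂ → ℂ} (h : ∀ z : Disc, f.val z = G z)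
    {z : Disc} {d : ℂ} (hG : HasDerivAt G d z) : f.der z = d := by
  refine (hG.congr_of_eventuallyEq ?_).deriv
  filter_upwards [Metric.isOpen_ball.mem_nhds z.2] with w hw
  rw [zeroExt_of_mem _ hw, h]

theorem HolD.der_sub (f g : HolD) (z : Disc) : (f - g).der z = f.der z - g.der z := by
  rw [sub_eq_add_neg, ← neg_one_smul ℂ g, der_add, der_smul, neg_one_mul, ← sub_eq_add_neg]

theorem HolD.isHol_der (f : HolD) : IsHol f.der :=
  (DifferentiableOn.deriv f.isHol Metric.isOpen_ball).congr fun _ hz => zeroExt_of_mem _ hz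

theorem HolD.continuous_der (f : HolD) : Continuous f.der :=
  f.isHol_der.continuousOn.domRestrict.congr fun z => zeroExt_coe _ z

theorem HolD.one_sub_norm_mul_norm_der_le (f : HolD) (z : Disc) {C : ℝ}
    (hC : ∀ w : Disc, ‖(w : ℂ)‖ ≤ (1 + ‖(z : ℂ)‖) / 2 → ‖f.val w‖ ≤ C) :
    (1 - ‖(z : ℂ)‖) * ‖f.der z‖ ≤ 2 * C := by
  set R := (1 - ‖(z : ℂ)‖) / 2 with hR
  have hR0 : 0 < R := half_pos (sub_pos.2 (norm_lt_one z))
  have hnorm : ∀ w ∈ Metric.closedBall (z : ℂ) R, ‖w‖ ≤ (1 + ‖(z : ℂ)‖) / 2 := fun w hw => by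
    have := norm_le_norm_add_norm_sub' w (z : ℂ)
    rw [mem_closedBall_iff_norm] at hw
    linarith
  have hsub : Metric.closedBall (z : ℂ) R ⊆ Disc := fun w hw =>
    mem_ball_zero_iff.2 (by linarith [hnorm w hw])
  have cauchy : ‖f.der z‖ ≤ C / R :=
    Complex.norm_deriv_le_of_forall_mem_sphere_norm_le hR0
      (DifferentiableOn.diffContOnCl_ball f.isHol hsub) fun w hw => by
        have hw' := Metric.sphere_subset_closedBall hw
        rw [zeroExt_of_mem _ (hsub hw')]
        exact hC _ (hnorm w hw')
  have hz : 1 - ‖(z : ℂ)‖ = 2 * R := by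
    rw [hR]
    ring
  rw [le_div_iff₀ hR0] at cauchy
  rw [hz]
  linarith

theorem HolD.exists_der_eq {F : Disc → ℂ} (hF : IsHol F) : ∃ P : HolD, ∀ z, P.der z = F z := by
  obtain ⟨P, hP⟩ := DifferentiableOn.isExactOn_ball hF
  refine ⟨.ofDifferentiableOn P fun z hz => (hP z hz).differentiableAt.differentiableWithinAt,
    fun z => der_eq_of_hasDerivAt (fun _ => rfl) ?_⟩
  rw [← zeroExt_coe F]
  exact hP z z.2

theorem HolD.exists_norm_val_sub_le (f : HolD) {z : Disc} {r C : ℝ} (hr : 0 ≤ r)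
    (hrz : r ≤ ‖(z : ℂ)‖)
    (hC : ∀ w : Disc, r ≤ ‖(w : ℂ)‖ → ‖(w : ℂ)‖ ≤ ‖(z : ℂ)‖ → ‖f.der w‖ ≤ C) :
    ∃ w : Disc, ‖(w : ℂ)‖ = r ∧ ‖f.val z - f.val w‖ ≤ C * (‖(z : ℂ)‖ - r) := by
  set τ := r / ‖(z : ℂ)‖
  have hτ0 : 0 ≤ τ := div_nonneg hr (norm_nonneg _)
  have hτ1 : τ ≤ 1 := div_le_one_of_le₀ hrz (norm_nonneg _)
  have hτz : τ * ‖(z : ℂ)‖ = r :=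
    div_mul_cancel_of_imp fun h0 => le_antisymm (hrz.trans h0.le) hr
  set s : Set ℂ := (fun t : ℝ => (t : ℂ) * z) '' Set.Icc τ 1
  have hs : Convex ℝ s := by
    simpa using (convex_Icc τ 1).linear_image (LinearMap.toSpanSingleton ℝ ℂ (z : ℂ))
  have hmem : ∀ t ∈ Set.Icc τ 1, (t : ℂ) * z ∈ Disc := fun t ht =>
    ofReal_mul_mem_disc ⟨hτ0.trans ht.1, ht.2⟩ z
  have hder : ∀ w ∈ s, ‖deriv (zeroExt f.val) w‖ ≤ C := by
    rintro _ ⟨t, ht, rfl⟩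
    have hnorm : ‖(t : ℂ) * z‖ = t * ‖(z : ℂ)‖ := norm_ofReal_mul (hτ0.trans ht.1) z
    refine hC ⟨_, hmem t ht⟩ ?_ ?_
    · rw [hnorm, ← hτz]
      exact mul_le_mul_of_nonneg_right ht.1 (norm_nonneg _)
    · rw [hnorm]
      exact mul_le_of_le_one_left (norm_nonneg _) ht.2
  refine ⟨⟨τ * z, hmem τ ⟨le_rfl, hτ1⟩⟩, (norm_ofReal_mul hτ0 z).trans hτz, ?_⟩
  have hdist : ‖(z - τ * z : ℂ)‖ = ‖(z : ℂ)‖ - r := by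
    have : (z - τ * z : ℂ) = ((1 - τ : ℝ) : ℂ) * z := by simp [sub_mul]
    rw [this, norm_ofReal_mul (sub_nonneg.2 hτ1), sub_mul, hτz, one_mul]
  have mvt := hs.norm_image_sub_le_of_norm_deriv_le
    (Set.forall_mem_image.2 fun t ht => f.differentiableAt ⟨_, hmem t ht⟩) hder
    (x := (τ * z : ℂ)) (y := (z : ℂ)) ⟨τ, ⟨le_rfl, hτ1⟩, rfl⟩ ⟨1, ⟨hτ1, le_rfl⟩, by simp⟩
  rwa [zeroExt_coe, zeroExt_of_mem _ (hmem τ ⟨le_rfl, hτ1⟩), hdist] at mvt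

theorem HolD.integral_segment_der (P : HolD) (w : Disc) :
    ∫ t in (0 : ℝ)..1, zeroExt P.der (t * w) * w = P.val w - P.val origin := by
  have hmem : ∀ t ∈ Set.Icc (0 : ℝ) 1, 0 + t • (w : ℂ) ∈ Disc := fun t ht => by
    simpa using ofReal_mul_mem_disc ht w
  have ftc := intervalIntegral.integral_unitInterval_deriv_eq_sub (z₀ := (0 : ℂ)) (z₁ := w)
    (P.isHol_der.continuousOn.comp (by fun_prop) hmem) fun t ht => by
      rw [zeroExt_of_mem _ (hmem t ht)]
      exact P.hasDerivAt ⟨_, hmem t ht⟩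
  have h0 : zeroExt P.val 0 = P.val origin := zeroExt_coe P.val origin
  simpa [zeroExt_coe, h0, mul_comm] using ftc

/-! ### Maximum modulus -/

/-- The maximum modulus `M(r, F) = max_{|z| ≤ r} |F(z)|` for continuous `F` and `0 ≤ r < 1`; it is
`0` for `r < 0`. -/
noncomputable def maxModulus (F : Disc → ℂ) (r : ℝ) : ℝ :=
  sSup ((fun z => ‖F z‖) '' {z : Disc | ‖(z : ℂ)‖ ≤ r})

theorem maxModulus_nonneg (F : Disc → ℂ) (r : ℝ) : 0 ≤ maxModulus F r :=
  Real.sSup_nonneg (Set.forall_mem_image.2 fun _ _ => norm_nonneg _)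

theorem norm_le_maxModulus {F : Disc → ℂ} (hF : Continuous F) {r : ℝ} (hr : r < 1) {z : Disc}
    (hz : ‖(z : ℂ)‖ ≤ r) : ‖F z‖ ≤ maxModulus F r :=
  le_csSup ((isCompact_setOf_norm_le hr).bddAbove_image hF.norm.continuousOn) ⟨z, hz, rfl⟩

theorem maxModulus_le {F : Disc → ℂ} {r C : ℝ} (hC : 0 ≤ C)
    (h : ∀ z : Disc, ‖(z : ℂ)‖ ≤ r → ‖F z‖ ≤ C) : maxModulus F r ≤ C :=
  Real.sSup_le (Set.forall_mem_image.2 h) hC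

theorem HolD.maxModulus_le_add (f : HolD) {r R C : ℝ} (hr : 0 ≤ r) (hrR : r ≤ R) (hr1 : r < 1)
    (hC0 : 0 ≤ C) (hC : ∀ w : Disc, r ≤ ‖(w : ℂ)‖ → ‖(w : ℂ)‖ ≤ R → ‖f.der w‖ ≤ C) :
    maxModulus f.val R ≤ maxModulus f.val r + C * (R - r) := by
  have hnonneg : 0 ≤ C * (R - r) := mul_nonneg hC0 (sub_nonneg.2 hrR)
  refine maxModulus_le (add_nonneg (maxModulus_nonneg _ _) hnonneg) fun z hzR => ?_
  rcases le_total ‖(z : ℂ)‖ r with hz | hz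
  · linarith [norm_le_maxModulus f.continuous_val hr1 hz]
  obtain ⟨w, hw, hzw⟩ := f.exists_norm_val_sub_le hr hz fun w h₁ h₂ => hC w h₁ (h₂.trans hzR)
  calc ‖f.val z‖ ≤ ‖f.val w‖ + ‖f.val z - f.val w‖ := norm_le_norm_add_norm_sub' _ _
    _ ≤ maxModulus f.val r + C * (R - r) := by
      gcongr
      · exact norm_le_maxModulus f.continuous_val hr1 hw.le
      · exact hzw.trans (by gcongr)

/-! ### Selfmaps and the Volterra operator -/

/-- A selfmap of the disc as an element of `H(𝔻)`, so that it has a derivative there. -/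
noncomputable def SelfMap.toHol (φ : SelfMap) : HolD := .ofDifferentiableOn _ φ.isHol

theorem SelfMap.toHol_val (φ : SelfMap) (z : Disc) : φ.toHol.val z = φ.toFun z :=
  zeroExt_coe (fun w => (φ.toFun w : ℂ)) z

theorem HolD.comp_der (g : HolD) (φ : SelfMap) (z : Disc) :
    (g.comp φ).der z = g.der (φ.toFun z) * φ.toHol.der z := by
  refine der_eq_of_hasDerivAt (G := zeroExt g.val ∘ zeroExt φ.toHol.val) (fun w => ?_) ?_
  · rw [Function.comp_apply, zeroExt_coe, φ.toHol_val, zeroExt_coe]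
    rfl
  · refine HasDerivAt.comp (z : ℂ) ?_ (φ.toHol.hasDerivAt z)
    rw [zeroExt_coe, φ.toHol_val]
    exact g.hasDerivAt _

theorem volterra_eq_sub {P f g : HolD} (h : ∀ z, P.der z = f.val z * g.der z) (φ : SelfMap)
    (z : Disc) : volterra g φ f z = P.val (φ.toFun z) - P.val origin := by
  rw [← P.integral_segment_der, volterra]
  refine intervalIntegral.integral_congr fun t ht => ?_
  rw [Set.uIcc_of_le zero_le_one] at ht
  have hmem := ofReal_mul_mem_disc ht (φ.toFun z)
  simp only [zeroExt_of_mem _ hmem, h]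

theorem der_of_val_eq_volterra {F f g : HolD} {φ : SelfMap}
    (hF : ∀ z, F.val z = volterra g φ f z) (z : Disc) :
    F.der z = f.val (φ.toFun z) * (g.comp φ).der z := by
  have hprod : IsHol fun z => f.val z * g.der z :=
    (DifferentiableOn.mul f.isHol g.isHol_der).congr fun w hw => by
      simp only [Pi.mul_apply, zeroExt_of_mem _ hw]
  obtain ⟨P, hP⟩ := HolD.exists_der_eq hprod
  have hFP : ∀ w : Disc, F.val w = zeroExt (P.comp φ).val w - P.val origin := fun w => by
    rw [hF, volterra_eq_sub hP, zeroExt_coe]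
    rfl
  rw [HolD.der_eq_of_hasDerivAt hFP (((P.comp φ).hasDerivAt z).sub_const _), P.comp_der, hP,
    g.comp_der, mul_assoc]

/-! ### Weighted spaces -/

theorem Weight.mul_norm_le_add (v : Weight) (z : Disc) (a b : ℂ) :
    v z * ‖a‖ ≤ v z * ‖b‖ + v z * ‖b - a‖ := by
  rw [← mul_add]
  exact mul_le_mul_of_nonneg_left (norm_le_norm_add_norm_sub _ _) (v.pos z).le

theorem Weight.mul_norm_nonneg (v : Weight) (z : Disc) (a : ℂ) : 0 ≤ v z * ‖a‖ :=
  mul_nonneg (v.pos z).le (norm_nonneg a)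

theorem HvInf.weight_mul_norm_val_le {v : Weight} (f : HvInf v) (z : Disc) :
    v z * ‖(HvInf.incl v f).val z‖ ≤ ‖f‖ := le_ciSup f.2 z

theorem BvInf.weight_mul_norm_der_le {v : Weight} (f : BvInf v) (z : Disc) :
    v z * ‖(BvInf.incl v f).der z‖ ≤ ‖f‖ :=
  (le_ciSup f.2 z).trans (le_add_of_nonneg_left (norm_nonneg _))

theorem isClosed_Hv0 (v : Weight) : IsClosed (Hv0 v : Set (HvInf v)) := by
  refine isClosed_of_closure_subset fun f hf =>
    tendsto_zero_of_forall_le_add (fun z => v.mul_norm_nonneg z _) fun ε hε => ?_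
  obtain ⟨b, hb, hfb⟩ := Metric.mem_closure_iff.1 hf ε hε
  rw [dist_eq_norm'] at hfb
  refine ⟨_, hb, .of_forall fun z => (v.mul_norm_le_add z _ _).trans (add_le_add_right ?_ _)⟩
  exact ((b - f).weight_mul_norm_val_le z).trans hfb.le

theorem BvInf.weight_mul_norm_der_sub_der_le {v : Weight} (f h : BvInf v) (z : Disc) :
    v z * ‖(BvInf.incl v f).der z - (BvInf.incl v h).der z‖ ≤ ‖f - h‖ := by
  rw [← HolD.der_sub, ← map_sub]
  exact (f - h).weight_mul_norm_der_le z

theorem isClosed_Bv0 (v : Weight) : IsClosed (Bv0 v : Set (BvInf v)) := by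
  refine isClosed_of_closure_subset fun f hf =>
    tendsto_zero_of_forall_le_add (fun z => v.mul_norm_nonneg z _) fun ε hε => ?_
  obtain ⟨b, hb, hfb⟩ := Metric.mem_closure_iff.1 hf ε hε
  rw [dist_eq_norm'] at hfb
  refine ⟨_, hb, .of_forall fun z => (v.mul_norm_le_add z _ _).trans (add_le_add_right ?_ _)⟩
  exact (b.weight_mul_norm_der_sub_der_le f z).trans hfb.le

theorem BvInf.continuous_der_apply (v : Weight) (z : Disc) :
    Continuous fun f : BvInf v => (BvInf.incl v f).der z := by
  refine (LipschitzWith.of_dist_le' (K := (v z)⁻¹) fun f h => ?_).continuous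
  rw [dist_eq_norm, dist_eq_norm, inv_mul_eq_div, le_div_iff₀' (v.pos z)]
  exact f.weight_mul_norm_der_sub_der_le h z

theorem mem_range_Bv0_incl {v : Weight} {f : HolD} :
    f ∈ LinearMap.range (Bv0.incl v) ↔
      Tendsto (fun z => v z * ‖f.der z‖) toBoundary (𝓝 0) := by
  constructor
  · rintro ⟨b, rfl⟩
    exact b.2
  · intro h
    exact ⟨⟨⟨f, bddAbove_range_of_tendsto_toBoundary
      (v.continuous.mul f.continuous_der.norm) h⟩, h⟩, rfl⟩

/-! ### Compact operators -/

section Compact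

variable {X : Type*} [NormedAddCommGroup X] [NormedSpace ℂ X] {ι : X →ₗ[ℂ] HolD}

theorem isCompactBetween_comp_subtype_iff {Y : Type*} [NormedAddCommGroup Y] [NormedSpace ℂ Y]
    {κ : Y →ₗ[ℂ] HolD} {V : Submodule ℂ Y} (hV : IsClosed (V : Set Y))
    {T : HolD → Disc → ℂ} :
    IsCompactBetween ι (κ ∘ₗ V.subtype) T ↔
      ∃ S : X →ₗ[ℂ] Y, (∀ f z, (κ (S f)).val z = T (ι f) z) ∧ IsCompactOperator S ∧
        ∀ f, S f ∈ V := by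
  constructor
  · rintro ⟨S, hS, hc⟩
    exact ⟨V.subtype ∘ₗ S, hS, hc.continuous_comp continuous_subtype_val, fun f => (S f).2⟩
  · rintro ⟨S, hS, hc, hmem⟩
    exact ⟨S.codRestrict V hmem, hS, hc.codRestrict hmem hV⟩

variable {v : Weight} {S : X →ₗ[ℂ] BvInf v}

theorem exists_forall_weight_mul_norm_der_sub_le (hc : IsCompactOperator S)
    {x : ℕ → X} {R : ℝ} (hx : ∀ n, ‖x n‖ ≤ R) {d : Disc → ℂ}
    (hd : ∀ z, Tendsto (fun n => (BvInf.incl v (S (x n))).der z) atTop (𝓝 (d z)))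
    {ε : ℝ} (hε : 0 < ε) :
    ∃ n, ∀ z, v z * ‖(BvInf.incl v (S (x n))).der z - d z‖ ≤ ε := by
  obtain ⟨K, hK, hSK⟩ := hc.image_closedBall_subset_compact R
  obtain ⟨h, -, σ, hσ, hh⟩ := hK.tendsto_subseq (x := fun n => S (x n)) fun n =>
    hSK ⟨x n, mem_closedBall_zero_iff.2 (hx n), rfl⟩
  have hder : (BvInf.incl v h).der = d := funext fun z =>
    tendsto_nhds_unique (((BvInf.continuous_der_apply v z).tendsto h).comp hh)
      ((hd z).comp hσ.tendsto_atTop)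
  obtain ⟨n, hn⟩ := (Metric.tendsto_nhds.1 hh ε hε).exists
  rw [dist_eq_norm] at hn
  exact ⟨σ n, fun z => hder ▸ (BvInf.weight_mul_norm_der_sub_der_le _ h z).trans hn.le⟩

/-! ### The Volterra operator into Bloch-type spaces -/

variable {g : HolD} {φ : SelfMap}

theorem IsDilation.norm_val_le {r : ℝ} {T : X → X} (hT : IsDilation ι r T)
    (hr : r ∈ Set.Ico (0 : ℝ) 1) (f : X) (z : Disc) :
    ‖(ι (T f)).val z‖ ≤ maxModulus (ι f).val r := by
  rw [hT, zeroExt_of_mem _ (ofReal_mul_mem_disc ⟨hr.1, hr.2.le⟩ z)]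
  refine norm_le_maxModulus (ι f).continuous_val hr.2 ?_
  rw [norm_ofReal_mul hr.1]
  exact mul_le_of_le_one_right hr.1 (norm_lt_one z).le

theorem tendsto_val_of_isDilation {α : Type*} {l : Filter α} {r : α → ℝ} {T : α → X → X}
    (hT : ∀ a, IsDilation ι (r a) (T a)) (hr : Tendsto r l (𝓝 1)) (f : X) (z : Disc) :
    Tendsto (fun a => (ι (T a f)).val z) l (𝓝 ((ι f).val z)) := by
  have hrz : Tendsto (fun a => (r a : ℂ) * z) l (𝓝 z) := by
    simpa using ((Complex.continuous_ofReal.tendsto 1).comp hr).mul_const (z : ℂ)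
  have hf := ((ι f).differentiableAt z).continuousAt.tendsto.comp hrz
  rw [zeroExt_coe] at hf
  exact hf.congr fun a => (hT a f z).symm

theorem comp_mem_range_Bv0_incl (hconst : ContainsConstants ι)
    (hS : ∀ f z, (BvInf.incl v (S f)).val z = volterra g φ (ι f) z) (hmem : ∀ f, S f ∈ Bv0 v) :
    g.comp φ ∈ LinearMap.range (Bv0.incl v) := by
  obtain ⟨e, he⟩ := hconst 1
  refine mem_range_Bv0_incl.2 ((hmem e).congr fun z => ?_)
  rw [der_of_val_eq_volterra (hS e), he, one_mul]

theorem mem_Bv0_of_condIV (hIV : CondIV ι)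
    (hS : ∀ f z, (BvInf.incl v (S f)).val z = volterra g φ (ι f) z) (hc : IsCompactOperator S)
    (hg : g.comp φ ∈ LinearMap.range (Bv0.incl v)) (f : X) : S f ∈ Bv0 v := by
  refine tendsto_zero_of_forall_le_add (fun z => v.mul_norm_nonneg z _) fun ε hε => ?_
  obtain ⟨C, hC⟩ := hIV
  obtain ⟨r, -, hr, hlim⟩ := exists_seq_strictMono_tendsto' (zero_lt_one (α := ℝ))
  choose T hT hTC using fun n => hC (r n) (hr n)
  have hder : ∀ h z, (BvInf.incl v (S h)).der z = (ι h).val (φ.toFun z) * (g.comp φ).der z :=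
    fun h => der_of_val_eq_volterra (hS h)
  obtain ⟨n, hn⟩ := exists_forall_weight_mul_norm_der_sub_le hc (x := fun n => T n f)
    (fun n => (T n).le_of_opNorm_le (hTC n) f) (fun z => by
      simpa only [hder] using (tendsto_val_of_isDilation hT hlim f _).mul_const _) hε
  refine ⟨fun z => maxModulus (ι f).val (r n) * (v z * ‖(g.comp φ).der z‖),
    by simpa using (mem_range_Bv0_incl.1 hg).const_mul _, .of_forall fun z => ?_⟩
  calc v z * ‖(BvInf.incl v (S f)).der z‖
      ≤ v z * ‖(BvInf.incl v (S (T n f))).der z‖ + ε :=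
        (v.mul_norm_le_add z _ _).trans (by gcongr; rw [hder f]; exact hn z)
    _ = ‖(ι (T n f)).val (φ.toFun z)‖ * (v z * ‖(g.comp φ).der z‖) + ε := by
        rw [hder, norm_mul, mul_left_comm]
    _ ≤ maxModulus (ι f).val (r n) * (v z * ‖(g.comp φ).der z‖) + ε := by
        gcongr
        · exact v.mul_norm_nonneg z _
        · exact (hT n).norm_val_le ⟨(hr n).1.le, (hr n).2⟩ f _

theorem CondV.exists_powMul (hV : CondV ι) (f : X) :
    ∃ (x : ℕ → X) (R : ℝ), (∀ n, ‖x n‖ ≤ R) ∧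
      ∀ n z, (ι (x n)).val z = (z : ℂ) ^ n * (ι f).val z := by
  obtain ⟨c, hc, h⟩ := hV
  have hle : ∀ (n : ℕ) (z : Disc), ‖(z : ℂ) ^ n‖ ≤ 1 := fun n z => by
    rw [norm_pow]
    exact pow_le_one₀ (norm_nonneg _) (norm_lt_one z).le
  choose M hM hMc using fun n : ℕ => h
    (.ofDifferentiableOn (fun z => z ^ n) (differentiable_pow n).differentiableOn)
    ⟨1, Set.forall_mem_range.2 (hle n)⟩
  have : Nonempty Disc := ⟨origin⟩
  exact ⟨fun n => M n f, c * 1 * ‖f‖, fun n => (M n).le_of_opNorm_le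
    ((hMc n).trans (mul_le_mul_of_nonneg_left (ciSup_le (hle n)) hc.le)) f, fun n => hM n f⟩

theorem exists_half_lt_pow (n : ℕ) : ∃ ρ ∈ Set.Ioo (0 : ℝ) 1, 1 / 2 < ρ ^ n := by
  have hlim : Tendsto (fun ρ : ℝ => ρ ^ n) (𝓝[<] 1) (𝓝 1) :=
    tendsto_nhdsWithin_of_tendsto_nhds ((continuous_pow n).tendsto' 1 1 (one_pow n))
  exact (Filter.Eventually.and (Ioo_mem_nhdsLT zero_lt_one)
    (hlim.eventually_const_lt one_half_lt_one)).exists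

theorem mem_Bv0_of_condV (hV : CondV ι)
    (hS : ∀ f z, (BvInf.incl v (S f)).val z = volterra g φ (ι f) z) (hc : IsCompactOperator S)
    (hφ : Tendsto (fun z => v z * ‖φ.toHol.der z‖) toBoundary (𝓝 0)) (f : X) : S f ∈ Bv0 v := by
  refine tendsto_zero_of_forall_le_add (fun z => v.mul_norm_nonneg z _) fun ε hε => ?_
  obtain ⟨x, R, hxR, hx⟩ := hV.exists_powMul f
  have hder : ∀ n z, (BvInf.incl v (S (x n))).der z =
      (φ.toFun z : ℂ) ^ n * (BvInf.incl v (S f)).der z := fun n z => by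
    rw [der_of_val_eq_volterra (hS _), der_of_val_eq_volterra (hS _), hx, mul_assoc]
  obtain ⟨n, hn⟩ := exists_forall_weight_mul_norm_der_sub_le hc hxR (d := fun _ => 0) (fun z => by
    simpa only [hder, zero_mul] using
      (tendsto_pow_atTop_nhds_zero_of_norm_lt_one (norm_lt_one (φ.toFun z))).mul_const _)
    (half_pos hε)
  obtain ⟨ρ, hρ, hρn⟩ := exists_half_lt_pow n
  refine ⟨fun z => maxModulus (fun w => (ι f).val w * g.der w) ρ * (v z * ‖φ.toHol.der z‖),
    by simpa using hφ.const_mul _, .of_forall fun z => ?_⟩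
  rcases le_total ‖(φ.toFun z : ℂ)‖ ρ with h | h
  · refine le_add_of_le_of_nonneg ?_ hε.le
    rw [der_of_val_eq_volterra (hS f), g.comp_der, ← mul_assoc, norm_mul, mul_left_comm]
    refine mul_le_mul_of_nonneg_right ?_ (v.mul_norm_nonneg z _)
    exact norm_le_maxModulus ((ι f).continuous_val.mul g.continuous_der) hρ.2 h
  · refine le_add_of_nonneg_of_le (mul_nonneg (maxModulus_nonneg _ _) (v.mul_norm_nonneg z _)) ?_
    have hpow : 1 / 2 ≤ ‖(φ.toFun z : ℂ)‖ ^ n :=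
      hρn.le.trans (pow_le_pow_left₀ hρ.1.le h n)
    have hsmall := hn z
    rw [sub_zero, hder, norm_mul, norm_pow, mul_left_comm] at hsmall
    linarith [mul_le_mul_of_nonneg_right hpow (v.mul_norm_nonneg z ((BvInf.incl v (S f)).der z))]

end Compact

/-! ### Normal weights -/

/-- The weight `(1 - |z|) v(z)`. -/
noncomputable def Weight.derWeight (v : Weight) : Weight where
  toFun z := (1 - ‖(z : ℂ)‖) * v z
  continuous := (continuous_const.sub continuous_subtype_val.norm).mul v.continuous
  pos z := mul_pos (sub_pos.2 (norm_lt_one z)) (v.pos z)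
  tendsto_zero := squeeze_zero
    (fun z => mul_nonneg (sub_pos.2 (norm_lt_one z)).le (v.pos z).le)
    (fun z => mul_le_of_le_one_left (v.pos z).le (sub_le_self 1 (norm_nonneg _)))
    v.tendsto_zero

theorem Weight.derWeight_apply (v : Weight) (z : Disc) :
    v.derWeight z = (1 - ‖(z : ℂ)‖) * v z := rfl

theorem SelfMap.tendsto_derWeight_mul_der (φ : SelfMap) (v : Weight) :
    Tendsto (fun z => v.derWeight z * ‖φ.toHol.der z‖) toBoundary (𝓝 0) := by
  refine squeeze_zero (fun z => v.derWeight.mul_norm_nonneg z _) (fun z => ?_)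
    (by simpa using v.tendsto_zero.const_mul (2 * 1))
  have cauchy := φ.toHol.one_sub_norm_mul_norm_der_le z (C := 1) fun w _ => by
    rw [φ.toHol_val]
    exact (norm_lt_one _).le
  rw [v.derWeight_apply, mul_right_comm]
  exact mul_le_mul_of_nonneg_right cauchy (v.pos z).le

namespace Weight.IsNormal

variable {v : Weight}

theorem exists_le_mul (hv : v.IsNormal) :
    ∃ D > 0, ∀ z w : Disc, ‖(w : ℂ)‖ ≤ (1 + ‖(z : ℂ)‖) / 2 → v z ≤ D * v w := by
  obtain ⟨D, hD⟩ := hv.sup_finite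
  have hstep : ∀ n, v (dyadicPt n) ≤ D * v (dyadicPt (n + 1)) := fun n =>
    (div_le_iff₀ (v.pos _)).1 (hD ⟨n, rfl⟩)
  have hD0 : 0 < D := pos_of_mul_pos_left ((v.pos _).trans_le (hstep 0)) (v.pos _).le
  refine ⟨D * D, mul_pos hD0 hD0, fun z w hw => ?_⟩
  obtain ⟨n, hn, hn'⟩ := exists_norm_dyadicPt_le_lt z
  have hwn : ‖(w : ℂ)‖ ≤ ‖(dyadicPt (n + 2) : ℂ)‖ := by
    rw [← one_add_norm_dyadicPt_div_two (n + 1)]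
    linarith
  calc v z ≤ v (dyadicPt n) := hv.antitone _ _ hn
    _ ≤ D * v (dyadicPt (n + 1)) := hstep n
    _ ≤ D * (D * v (dyadicPt (n + 2))) := by
      gcongr
      exact hstep (n + 1)
    _ ≤ D * (D * v w) := by
      gcongr
      exact hv.antitone _ _ hwn
    _ = D * D * v w := (mul_assoc ..).symm

theorem antitone_dyadicPt (hv : v.IsNormal) : Antitone fun n => v (dyadicPt n) := fun _ _ h =>
  hv.antitone _ _ (monotone_norm_dyadicPt h)

theorem exists_contraction (hv : v.IsNormal) :
    ∃ k > 0, ∃ q ∈ Set.Ico (0 : ℝ) 1, ∀ᶠ n in atTop,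
      v (dyadicPt (n + k)) ≤ q * v (dyadicPt n) := by
  obtain ⟨k, hk⟩ := exists_lt_of_ciInf_lt hv.limsup_lt
  obtain ⟨q, hkq, hq⟩ := exists_between hk
  have hbdd : atTop.IsBoundedUnder (· ≤ ·)
      (fun n : ℕ => v (dyadicPt (n + k)) / v (dyadicPt n)) :=
    isBoundedUnder_of ⟨1, fun n =>
      (div_le_one (v.pos _)).2 (hv.antitone_dyadicPt (Nat.le_add_right n k))⟩
  have hev : ∀ᶠ n in atTop, v (dyadicPt (n + k)) < q * v (dyadicPt n) :=
    (eventually_lt_of_limsup_lt hkq hbdd).mono fun n hn => (div_lt_iff₀ (v.pos _)).1 hn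
  obtain ⟨n, hn⟩ := hev.exists
  have hq0 : 0 < q := pos_of_mul_pos_left ((v.pos _).trans hn) (v.pos _).le
  refine ⟨k, Nat.pos_of_ne_zero ?_, q, ⟨hq0.le, hq⟩, hev.mono fun n hn => hn.le⟩
  rintro rfl
  exact hn.not_ge (mul_le_of_le_one_left (v.pos _).le hq.le)

theorem exists_derWeight_mul_norm_der_le (hv : v.IsNormal) :
    ∃ C, ∀ (f : HvInf v) (z : Disc), v.derWeight z * ‖(HvInf.incl v f).der z‖ ≤ C * ‖f‖ := by
  obtain ⟨D, hD0, hD⟩ := hv.exists_le_mul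
  refine ⟨2 * D, fun f z => ?_⟩
  have cauchy := (HvInf.incl v f).one_sub_norm_mul_norm_der_le z (C := D * ‖f‖ / v z)
    fun w hw => by
      rw [le_div_iff₀' (v.pos z)]
      calc v z * ‖(HvInf.incl v f).val w‖ ≤ D * v w * ‖(HvInf.incl v f).val w‖ := by
            gcongr
            exact hD z w hw
        _ ≤ D * ‖f‖ := by
            rw [mul_assoc]
            gcongr
            exact f.weight_mul_norm_val_le w
  calc v.derWeight z * ‖(HvInf.incl v f).der z‖
      = (1 - ‖(z : ℂ)‖) * ‖(HvInf.incl v f).der z‖ * v z := mul_right_comm ..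
    _ ≤ 2 * (D * ‖f‖ / v z) * v z := mul_le_mul_of_nonneg_right cauchy (v.pos z).le
    _ = 2 * D * ‖f‖ := by
      have := (v.pos z).ne'
      field_simp

end Weight.IsNormal

/-- The bounded inclusion of `H_v^∞` into the Bloch-type space for `(1 - |z|) v(z)`. -/
noncomputable def HvInf.toBvInf {v : Weight} (hv : v.IsNormal) :
    HvInf v →L[ℂ] BvInf v.derWeight :=
  LinearMap.mkContinuousOfExistsBound
    (Submodule.inclusion (p := hvInfSubmodule v) (p' := bvInfSubmodule v.derWeight) fun f hf => by
      obtain ⟨C, hC⟩ := hv.exists_derWeight_mul_norm_der_le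
      exact ⟨_, Set.forall_mem_range.2 (hC ⟨f, hf⟩)⟩) <| by
    obtain ⟨C, hC⟩ := hv.exists_derWeight_mul_norm_der_le
    have : Nonempty Disc := ⟨origin⟩
    refine ⟨(v origin)⁻¹ + C, fun f => ?_⟩
    rw [add_mul, inv_mul_eq_div]
    refine add_le_add ((le_div_iff₀' (v.pos _)).2 ?_) (ciSup_le (hC f))
    exact f.weight_mul_norm_val_le origin

/-! ### From little-o growth of the derivative to little-o growth of the function -/

namespace Weight.IsNormal

variable {v : Weight}

theorem eventually_maxModulus_dyadicPt_succ_le (hv : v.IsNormal) {f : HolD}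
    (hf : Tendsto (fun z => v.derWeight z * ‖f.der z‖) toBoundary (𝓝 0)) {ε : ℝ} (hε : 0 < ε) :
    ∀ᶠ n in atTop, maxModulus f.val ‖(dyadicPt (n + 1) : ℂ)‖ ≤
      maxModulus f.val ‖(dyadicPt n : ℂ)‖ + ε / v (dyadicPt (n + 1)) := by
  obtain ⟨N, -, hN⟩ := hasBasis_toBoundary.eventually_iff.1 (hf.eventually_lt_const hε)
  filter_upwards [eventually_ge_atTop N] with n hn
  set d := dyadicPt (n + 1)
  have hd1 : 0 < 1 - ‖(d : ℂ)‖ := sub_pos.2 (norm_lt_one d)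
  have hder : ∀ w : Disc, ‖(dyadicPt n : ℂ)‖ ≤ ‖(w : ℂ)‖ → ‖(w : ℂ)‖ ≤ ‖(d : ℂ)‖ →
      ‖f.der w‖ ≤ ε / v.derWeight d := fun w hnw hwd => by
    have hdw : v.derWeight d ≤ v.derWeight w :=
      mul_le_mul (sub_le_sub_left hwd 1) (hv.antitone _ _ hwd) (v.pos d).le
        (sub_pos.2 (norm_lt_one w)).le
    rw [le_div_iff₀' (v.derWeight.pos d)]
    exact (mul_le_mul_of_nonneg_right hdw (norm_nonneg _)).trans
      (hN ((monotone_norm_dyadicPt hn).trans hnw)).le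
  have hgap : ‖(d : ℂ)‖ - ‖(dyadicPt n : ℂ)‖ = 1 - ‖(d : ℂ)‖ := by
    linarith [one_add_norm_dyadicPt_div_two n]
  convert f.maxModulus_le_add (norm_nonneg _) (monotone_norm_dyadicPt n.le_succ)
    (norm_lt_one _) (div_pos hε (v.derWeight.pos d)).le hder using 2
  rw [hgap, derWeight_apply, div_mul_eq_mul_div, mul_comm ε, mul_div_mul_left _ _ hd1.ne']

theorem eventually_maxModulus_dyadicPt_add_le (hv : v.IsNormal) {f : HolD}
    (hf : Tendsto (fun z => v.derWeight z * ‖f.der z‖) toBoundary (𝓝 0)) {ε : ℝ} (hε : 0 < ε)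
    (k : ℕ) :
    ∀ᶠ n in atTop, maxModulus f.val ‖(dyadicPt (n + k) : ℂ)‖ ≤
      maxModulus f.val ‖(dyadicPt n : ℂ)‖ + k * ε / v (dyadicPt (n + k)) := by
  induction k with
  | zero => simp
  | succ k ih =>
    filter_upwards [ih, (tendsto_add_atTop_nat k).eventually
      (hv.eventually_maxModulus_dyadicPt_succ_le hf hε)] with n hn hstep
    have hanti : k * ε / v (dyadicPt (n + k)) ≤ k * ε / v (dyadicPt (n + k + 1)) :=
      div_le_div_of_nonneg_left (by positivity) (v.pos _) (hv.antitone_dyadicPt (Nat.le_succ _))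
    rw [Nat.cast_succ, add_one_mul, add_div, ← add_assoc n]
    linarith

theorem tendsto_mul_maxModulus_dyadicPt (hv : v.IsNormal) {f : HolD}
    (hf : Tendsto (fun z => v.derWeight z * ‖f.der z‖) toBoundary (𝓝 0)) :
    Tendsto (fun n => v (dyadicPt n) * maxModulus f.val ‖(dyadicPt n : ℂ)‖) atTop (𝓝 0) := by
  obtain ⟨k, hk, q, hq, hkq⟩ := hv.exists_contraction
  refine tendsto_zero_of_eventually_le_mul_add
    (fun n => mul_nonneg (v.pos _).le (maxModulus_nonneg _ _)) hk hq fun ε hε => ?_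
  have hk0 : (0 : ℝ) < k := Nat.cast_pos.2 hk
  filter_upwards [hkq, hv.eventually_maxModulus_dyadicPt_add_le hf (div_pos hε hk0) k]
    with n hn hM
  have hpos := v.pos (dyadicPt (n + k))
  calc v (dyadicPt (n + k)) * maxModulus f.val ‖(dyadicPt (n + k) : ℂ)‖
      ≤ v (dyadicPt (n + k)) * (maxModulus f.val ‖(dyadicPt n : ℂ)‖ +
          k * (ε / k) / v (dyadicPt (n + k))) := by gcongr
    _ = v (dyadicPt (n + k)) * maxModulus f.val ‖(dyadicPt n : ℂ)‖ + ε := by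
        field_simp
    _ ≤ q * (v (dyadicPt n) * maxModulus f.val ‖(dyadicPt n : ℂ)‖) + ε := by
        rw [← mul_assoc]
        gcongr
        exact maxModulus_nonneg _ _

theorem tendsto_val_of_tendsto_der (hv : v.IsNormal) {f : HolD}
    (hf : Tendsto (fun z => v.derWeight z * ‖f.der z‖) toBoundary (𝓝 0)) :
    Tendsto (fun z => v z * ‖f.val z‖) toBoundary (𝓝 0) := by
  obtain ⟨D, hD0, hD⟩ := hv.exists_le_mul
  refine tendsto_order.2 ⟨fun c hc => .of_forall fun z => hc.trans_le (v.mul_norm_nonneg z _),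
    fun ε hε => hasBasis_toBoundary.eventually_iff.2 ?_⟩
  have hlim := (hv.tendsto_mul_maxModulus_dyadicPt hf).const_mul D
  rw [mul_zero] at hlim
  obtain ⟨N, hN⟩ := eventually_atTop.1 (hlim.eventually_lt_const hε)
  refine ⟨N, trivial, fun z hz => ?_⟩
  obtain ⟨n, hn, hn'⟩ := exists_norm_dyadicPt_le_lt z
  have hNn : N ≤ n + 1 := (monotone_norm_dyadicPt.reflect_lt (lt_of_le_of_lt hz hn')).le
  have hvz : v z ≤ D * v (dyadicPt (n + 1)) := hD z _ <| by
    rw [← one_add_norm_dyadicPt_div_two n]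
    linarith
  calc v z * ‖f.val z‖
      ≤ D * v (dyadicPt (n + 1)) * maxModulus f.val ‖(dyadicPt (n + 1) : ℂ)‖ := by
        gcongr
        · exact mul_nonneg hD0.le (v.pos _).le
        · exact norm_le_maxModulus f.continuous_val (norm_lt_one _) hn'.le
    _ < ε := by
        rw [mul_assoc]
        exact hN _ hNn

end Weight.IsNormal

theorem mem_Hv0_of_condV {X : Type*} [NormedAddCommGroup X] [NormedSpace ℂ X]
    {ι : X →ₗ[ℂ] HolD} {g : HolD} {φ : SelfMap} {v : Weight} {S : X →ₗ[ℂ] HvInf v}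
    (hV : CondV ι) (hv : v.IsNormal)
    (hS : ∀ f z, (HvInf.incl v (S f)).val z = volterra g φ (ι f) z) (hc : IsCompactOperator S)
    (f : X) : S f ∈ Hv0 v :=
  hv.tendsto_val_of_tendsto_der <|
    mem_Bv0_of_condV (S := (HvInf.toBvInf hv).toLinearMap ∘ₗ S) hV hS
      (hc.clm_comp (HvInf.toBvInf hv)) (φ.tendsto_derWeight_mul_der v) f

end VolterraDisc

theorem theorem3p12_general {X : Type*} [NormedAddCommGroup X] [NormedSpace ℂ X]
    (ι : X →ₗ[ℂ] HolD) (g : HolD) (φ : SelfMap) (v : Weight) :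
    (CondV ι → v.IsNormal →
      (IsCompactBetween ι (HvInf.incl v) (volterra g φ) ↔
        IsCompactBetween ι (Hv0.incl v) (volterra g φ))) ∧
    (ContainsConstants ι → CondIV ι →
      (IsCompactBetween ι (Bv0.incl v) (volterra g φ) ↔
        IsCompactBetween ι (BvInf.incl v) (volterra g φ) ∧
          g.comp φ ∈ LinearMap.range (Bv0.incl v))) := by
  constructor
  · refine fun hV hv => Iff.trans ?_ (isCompactBetween_comp_subtype_iff (isClosed_Hv0 v)).symm
    exact exists_congr fun S => and_congr_right fun hS =>
      ⟨fun hc => ⟨hc, mem_Hv0_of_condV hV hv hS hc⟩, And.left⟩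
  · refine fun hconst hIV =>
      (isCompactBetween_comp_subtype_iff (isClosed_Bv0 v)).trans ⟨?_, ?_⟩
    · rintro ⟨S, hS, hc, hmem⟩
      exact ⟨⟨S, hS, hc⟩, comp_mem_range_Bv0_incl hconst hS hmem⟩
    · rintro ⟨⟨S, hS, hc⟩, hg⟩
      exact ⟨S, hS, hc, mem_Bv0_of_condIV hIV hS hc hg⟩

theorem theorem3p12 {X : Type*} [NormedAddCommGroup X] [NormedSpace ℂ X] [CompleteSpace X]
    (ι : X →ₗ[ℂ] HolD) (hι : Function.Injective ι) (hconst : ContainsConstants ι)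
    (g : HolD) (φ : SelfMap) :
    (CondI ι → CondII ι → CondIII ι → CondIV ι → CondV ι →
      ∀ v : Weight, v.IsNormal →
        (IsCompactBetween ι (HvInf.incl v) (volterra g φ) ↔
          IsCompactBetween ι (Hv0.incl v) (volterra g φ))) ∧
    (CondI ι → CondIV ι →
      ∀ v : Weight,
        (IsCompactBetween ι (Bv0.incl v) (volterra g φ) ↔
          IsCompactBetween ι (BvInf.incl v) (volterra g φ) ∧
            g.comp φ ∈ LinearMap.range (Bv0.incl v))) :=
  ⟨fun _ _ _ _ hV v => (theorem3p12_general ι g φ v).1 hV,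
    fun _ hIV v => (theorem3p12_general ι g φ v).2 hconst hIV⟩
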